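/- Let $n\ge 1$, let $V\in\mathbb{C}^{n\times n}$ have rows $v_1,\dots,v_n\in\mathbb{C}^n$, and let $A=VV^\dagger$. Let $$\operatorname{per}(A)=\sum_{\sigma\in S_n}\prod_{i=1}^n A_{i,\sigma(i)},\qquad r(V)=\max_{x\in\mathbb{C}^n,\ \|x\|_2=1}\ \prod_{i=1}^n|\langle x,v_i\rangle|^2,$$ where $\|x\|_2=\big(\tfrac1n\sum_{k=1}^n|x_k|^2\big)^{1/2}$ is the normalized $2$-norm, and let $$\mathrm{SDP}(V)=\max_{X\succeq 0,\ \operatorname{tr}(X)=n}\ \prod_{i=1}^n v_i^\dagger X v_i ,$$ the maximum being over Hermitian positive semidefinite $X\in\mathbb{C}^{n\times n}$ of trace $n$. Suppose that $A\preceq I$ and that a maximizer $X^*$ of $\mathrm{SDP}(V)$ satisfies $v_i^\dagger X^* v_i=1$ for all $i=1,\dots,n$. Then $\operatorname{per}(A)$ is real and, for every $0\le\beta<1$, $$\operatorname{per}(A)\ \ge\ e^{-n}\,r(V)\ \ge\ e^{-(\gamma+1)n}\exp\!\left(n\left(\ln(1-\beta)+\frac{\beta}{1-\beta}\cdot\frac{\operatorname{tr}(A)}{n}-\frac{0.273\,\beta^2}{(1-\beta)^2}\cdot\frac{n}{\operatorname{tr}(A)}\right)\right),$$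 where $\gamma$ is the Euler–Mascheroni constant. (The hypotheses force $\operatorname{tr}(A)>0$. At $\beta=1$ the last expression is undefined; its limit as $\beta\to1^-$ is $0$.) -/

import Mathlib

open scoped Matrix ComplexOrder

noncomputable section

namespace PSDPermanent

/-- The normalized (expectation) `2`-norm `‖x‖₂ = (𝔼_{i ∼ [d]} |x_i|²)^{1/2}` on `ℂ^d`. -/
def expNorm {d : ℕ} (x : Fin d → ℂ) : ℝ :=
  Real.sqrt ((∑ k, ‖x k‖ ^ 2) / d)

/-- The objective `∏_{i ∈ [n]} |⟨x, v_i⟩|²`, where `v_1, …, v_n` are the rows of `V`. -/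
def linearFormsProd {n d : ℕ} (V : Matrix (Fin n) (Fin d) ℂ) (x : Fin d → ℂ) : ℝ :=
  ∏ i, ‖star x ⬝ᵥ V i‖ ^ 2

/-- `r(V) = max_{‖x‖₂ = 1} ∏_{i ∈ [n]} |⟨x, v_i⟩|²`, with the normalized `2`-norm.
By `isGreatest_r` the supremum is a maximum as soon as `d ≥ 1`. -/
def r {n d : ℕ} (V : Matrix (Fin n) (Fin d) ℂ) : ℝ :=
  sSup (linearFormsProd V '' {x | expNorm x = 1})

theorem isGreatest_r {n d : ℕ} (hd : 0 < d) (V : Matrix (Fin n) (Fin d) ℂ) :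
    IsGreatest (linearFormsProd V '' {x | expNorm x = 1}) (r V) := by
  have hd' : (0 : ℝ) < d := by exact_mod_cast hd
  have hc : Continuous (expNorm (d := d)) := by unfold expNorm; fun_prop
  have hf : Continuous (linearFormsProd V) := by
    unfold linearFormsProd dotProduct
    simp only [Pi.star_apply]
    fun_prop
  have hne : ({x | expNorm x = 1} : Set (Fin d → ℂ)).Nonempty :=
    ⟨fun _ => 1, by simp [expNorm, hd'.ne']⟩
  have hK : IsCompact ({x | expNorm x = 1} : Set (Fin d → ℂ)) := by
    refine Metric.isCompact_of_isClosed_isBounded (isClosed_eq hc continuous_const) ?_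
    refine (Metric.isBounded_closedBall (x := (0 : Fin d → ℂ)) (r := Real.sqrt d)).subset ?_
    intro x hx
    have hx1 : (∑ k, ‖x k‖ ^ 2) / (d : ℝ) = 1 := Real.sqrt_eq_one.1 hx
    have hx2 : ∑ k, ‖x k‖ ^ 2 = (d : ℝ) := by
      rwa [div_eq_one_iff_eq hd'.ne'] at hx1
    rw [mem_closedBall_zero_iff, pi_norm_le_iff_of_nonneg (Real.sqrt_nonneg _)]
    intro k
    refine Real.le_sqrt_of_sq_le ?_
    rw [← hx2]
    exact Finset.single_le_sum (f := fun k => ‖x k‖ ^ 2) (fun _ _ => by positivity)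
      (Finset.mem_univ k)
  exact (hK.image hf).isGreatest_sSup (hne.image _)

/-- The feasible set `{X ⪰ 0, tr X = n}` of the semidefinite program. -/
def sdpFeasible (n : ℕ) : Set (Matrix (Fin n) (Fin n) ℂ) :=
  {X | X.PosSemidef ∧ X.trace = n}

/-- The quadratic form `v_i† X v_i`, where `v_i` is the `i`-th row of `V`. -/
def rowForm {n : ℕ} (V X : Matrix (Fin n) (Fin n) ℂ) (i : Fin n) : ℂ :=
  star (V i) ⬝ᵥ (X *ᵥ V i)

/-- The objective `∏_{i ∈ [n]} v_i† X v_i` of `SDP(V)`; each factor is a nonnegative real number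
when `X ⪰ 0`. -/
def sdpObjective {n : ℕ} (V X : Matrix (Fin n) (Fin n) ℂ) : ℝ :=
  ∏ i, (rowForm V X i).re

/-- `X` is a maximizer of `SDP(V) = max_{X ⪰ 0, tr X = n} ∏_{i ∈ [n]} v_i† X v_i`. -/
def IsSDPMaximizer {n : ℕ} (V X : Matrix (Fin n) (Fin n) ℂ) : Prop :=
  X ∈ sdpFeasible n ∧ IsMaxOn (sdpObjective V) (sdpFeasible n) X

end PSDPermanent

end

noncomputable section

namespace PSDPermanent

open MeasureTheory Real Set

/-! The first inequality is Cauchy–Schwarz on tensors. Let `V_f` be the matrix whose columns are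
those of `V` picked by `f : Fin n → Fin n`. Then n! ∏ ⟨x, v_i⟩ is the pairing of the array f ↦
per(V_f) with the n-th tensor power of x, and that array has squared norm n! per(VV†). If Σ|x_k|² =
n, this gives n! ∏|⟨x, v_i⟩|² ≤ per(A) nⁿ, and nⁿ/n! ≤ eⁿ.

The second inequality rounds X = B†B to a random vector y = σ gB + w. Here g is standard complex
Gaussian, w = c Σ_j u_j v̄_j with independent uniform fourth roots of unity u_j, σ² = 1 - β and c² =
βn/tr(A), so that E‖y‖² = n in the unnormalized norm. Since v_i†Xv_i = 1, the form y·v_i is σ times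
a standard complex Gaussian plus c(Au)_i. Rescaling y to the sphere costs n log(‖y‖²/n) ≤ ‖y‖² - n,
which has mean 0, so log r(V) ≥ Σ_i E 2 log|y·v_i|.

Jensen's formula on circles gives 2 E log|g + z| ≥ -γ + |z|² - |z|⁴/4. Averaging over u leaves q_i =
Σ_j |A_ij|² and 2q_i² - Σ_j |A_ij|⁴. From A² ⪯ A one gets A_ii² ≤ q_i ≤ A_ii, and a one-variable
estimate bounds the quartic term by 1.092 A_ii; a quarter of this is the constant 0.273. Finally Σ
A_ii² ≥ tr(A)²/n. -/

/-! ### The complex Gaussian: characteristic function and invariance -/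

/-- The standard complex Gaussian measure on `ℂ`, of density `π⁻¹ exp (-‖z‖²)`. -/
def complexGaussian : Measure ℂ :=
  volume.withDensity fun z => ENNReal.ofReal (π⁻¹ * Real.exp (-‖z‖ ^ 2))

theorem complexGaussian_le_volume : complexGaussian ≤ volume := by
  have h : (fun z : ℂ => ENNReal.ofReal (π⁻¹ * Real.exp (-‖z‖ ^ 2))) ≤ 1 := by
    intro z
    simp only [Pi.one_apply]
    rw [ENNReal.ofReal_le_one]
    have h1 : π⁻¹ ≤ 1 := inv_le_one_of_one_le₀ (by linarith [pi_gt_three])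
    have h2 : Real.exp (-‖z‖ ^ 2) ≤ 1 := Real.exp_le_one_iff.2 (by nlinarith [sq_nonneg ‖z‖])
    exact mul_le_one₀ h1 (Real.exp_pos _).le h2
  calc complexGaussian ≤ volume.withDensity 1 := withDensity_mono (ae_of_all _ h)
    _ = volume := withDensity_one

theorem measurable_complexGaussian_density :
    Measurable fun z : ℂ => ENNReal.ofReal (π⁻¹ * Real.exp (-‖z‖ ^ 2)) := by fun_prop

theorem integral_complexGaussian {E : Type*} [NormedAddCommGroup E] [NormedSpace ℝ E]
    (f : ℂ → E) :
    ∫ z, f z ∂complexGaussian = ∫ z, (π⁻¹ * Real.exp (-‖z‖ ^ 2)) • f z := by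
  rw [complexGaussian, integral_withDensity_eq_integral_toReal_smul
    measurable_complexGaussian_density (ae_of_all _ fun _ => ENNReal.ofReal_lt_top)]
  refine integral_congr_ae (ae_of_all _ fun z => ?_)
  simp only
  rw [ENNReal.toReal_ofReal (by positivity)]

theorem integrable_complexGaussian_iff {f : ℂ → ℝ} :
    Integrable f complexGaussian ↔
      Integrable (fun z => (π⁻¹ * Real.exp (-‖z‖ ^ 2)) * f z) volume := by
  rw [complexGaussian, integrable_withDensity_iff_integrable_smul'
    measurable_complexGaussian_density (ae_of_all _ fun _ => ENNReal.ofReal_lt_top)]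
  refine integrable_congr (ae_of_all _ fun z => ?_)
  simp only [smul_eq_mul]
  rw [ENNReal.toReal_ofReal (by positivity)]

theorem integral_complexGaussian_cexp_inner (t : ℂ) :
    ∫ z, Complex.exp ((inner ℝ z t : ℝ) * Complex.I) ∂complexGaussian =
      Complex.exp (-((‖t‖ ^ 2 / 4 : ℝ) : ℂ)) := by
  have h := GaussianFourier.integral_cexp_neg_mul_sq_norm_add (V := ℂ) (b := 1) (by simp)
    Complex.I t
  rw [integral_complexGaussian]
  have h2 : ∀ z : ℂ, (π⁻¹ * Real.exp (-‖z‖ ^ 2)) •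
      Complex.exp ((inner ℝ z t : ℝ) * Complex.I) =
      (π : ℂ)⁻¹ * Complex.exp (-1 * (‖z‖ : ℂ) ^ 2 + Complex.I * (inner ℝ t z : ℝ)) := by
    intro z
    rw [Complex.exp_add, real_inner_comm z t, Complex.real_smul]
    push_cast
    rw [mul_assoc, neg_one_mul, mul_comm Complex.I]
  simp_rw [h2]
  rw [integral_const_mul, h]
  simp only [Complex.finrank_real_complex, div_one, Complex.I_sq]
  norm_num
  ring_nf

instance : IsProbabilityMeasure complexGaussian := by
  have h0 : ∫ z : ℂ, (π⁻¹ * Real.exp (-‖z‖ ^ 2)) = 1 := by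
    have h := GaussianFourier.integral_rexp_neg_mul_sq_norm (V := ℂ) (b := 1) one_pos
    rw [integral_const_mul]
    simp only [neg_mul, one_mul, Complex.finrank_real_complex, div_one] at h
    rw [h]
    norm_num
  have hi : Integrable (fun z : ℂ => (π⁻¹ * Real.exp (-‖z‖ ^ 2))) :=
    Integrable.of_integral_ne_zero (by rw [h0]; exact one_ne_zero)
  refine ⟨?_⟩
  rw [complexGaussian, withDensity_apply _ MeasurableSet.univ, Measure.restrict_univ,
    ← ofReal_integral_eq_lintegral_ofReal hi (ae_of_all _ fun _ => by positivity), h0]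
  simp

theorem charFun_complexGaussian (t : ℂ) :
    charFun complexGaussian t = Complex.exp (-((‖t‖ ^ 2 / 4 : ℝ) : ℂ)) := by
  rw [charFun_apply, integral_complexGaussian_cexp_inner]

theorem real_inner_mul_left (a z t : ℂ) :
    (inner ℝ (z * a) t : ℝ) = inner ℝ z (star a * t) := by
  simp only [Complex.inner, map_mul, Complex.star_def]
  congr 1
  ring

/-- A linear form with coefficients of unit `2`-norm of independent standard complex Gaussians is a
standard complex Gaussian. -/
theorem map_sum_mul_pi_complexGaussian {ι : Type*} [Fintype ι] (b : ι → ℂ)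
    (hb : ∑ i, ‖b i‖ ^ 2 = 1) :
    (Measure.pi fun _ : ι => complexGaussian).map (fun g => ∑ i, g i * b i) =
      complexGaussian := by
  have hm : Measurable fun g : ι → ℂ => ∑ i, g i * b i := by fun_prop
  have : IsProbabilityMeasure ((Measure.pi fun _ : ι => complexGaussian).map
    (fun g => ∑ i, g i * b i)) := Measure.isProbabilityMeasure_map hm.aemeasurable
  -- The characteristic function factors over the independent coordinates, and the exponents ‖b
  -- i‖²‖t‖²/4 add up to ‖t‖²/4.
  refine Measure.ext_of_charFun (funext fun t => ?_)
  rw [charFun_complexGaussian, charFun_apply, integral_map hm.aemeasurable (by fun_prop)]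
  have h1 : ∀ g : ι → ℂ, Complex.exp ((inner ℝ (∑ i, g i * b i) t : ℝ) * Complex.I) =
      ∏ i, Complex.exp ((inner ℝ (g i) (star (b i) * t) : ℝ) * Complex.I) := by
    intro g
    rw [sum_inner, ← Complex.exp_sum, Complex.ofReal_sum, Finset.sum_mul]
    simp_rw [real_inner_mul_left]
  simp_rw [h1]
  rw [integral_fintype_prod_eq_prod
    (f := fun i (z : ℂ) => Complex.exp ((inner ℝ z (star (b i) * t) : ℝ) * Complex.I))]
  simp_rw [integral_complexGaussian_cexp_inner]
  rw [← Complex.exp_sum, Finset.sum_neg_distrib, ← Complex.ofReal_sum]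
  congr 3
  simp_rw [norm_mul, norm_star, mul_pow]
  rw [← Finset.sum_div, ← Finset.sum_mul, hb, one_mul]

theorem map_mul_complexGaussian (u : ℂ) (hu : ‖u‖ = 1) :
    complexGaussian.map (fun z => z * u) = complexGaussian := by
  have : IsProbabilityMeasure (complexGaussian.map (fun z => z * u)) :=
    Measure.isProbabilityMeasure_map (by fun_prop)
  refine Measure.ext_of_charFun (funext fun t => ?_)
  rw [charFun_apply, integral_map (by fun_prop) (by fun_prop)]
  simp_rw [real_inner_mul_left]
  rw [integral_complexGaussian_cexp_inner, charFun_complexGaussian, norm_mul, norm_star, hu,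
    one_mul]

/-! ### Radial integrals and moments of the Gaussian -/

theorem integral_complexGaussian_norm (f : ℝ → ℝ) :
    ∫ z, f ‖z‖ ∂complexGaussian = 2 * ∫ y in Ioi (0 : ℝ), y * Real.exp (-y ^ 2) * f y := by
  rw [integral_complexGaussian]
  have h := integral_fun_norm_addHaar (E := ℂ) volume
    (fun y => (π⁻¹ * Real.exp (-y ^ 2)) • f y)
  rw [h, Complex.finrank_real_complex]
  have hv : (volume : Measure ℂ).real (Metric.ball 0 1) = π := by
    rw [Measure.real, Complex.volume_ball]; simp
  rw [hv]
  simp only [smul_eq_mul, nsmul_eq_mul, ← integral_const_mul]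
  refine setIntegral_congr_fun measurableSet_Ioi fun y _ => ?_
  simp only [Nat.add_one_sub_one, pow_one]
  push_cast
  field_simp

theorem integrable_complexGaussian_norm_iff (f : ℝ → ℝ) :
    Integrable (fun z => f ‖z‖) complexGaussian ↔
      IntegrableOn (fun y => y * Real.exp (-y ^ 2) * f y) (Ioi 0) := by
  rw [integrable_complexGaussian_iff]
  have h := integrable_fun_norm_addHaar (E := ℂ) volume
    (f := fun y => (π⁻¹ * Real.exp (-y ^ 2)) * f y)
  rw [h, Complex.finrank_real_complex]
  simp only [smul_eq_mul, Nat.add_one_sub_one, pow_one]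
  have : (fun y : ℝ => y * (π⁻¹ * Real.exp (-y ^ 2) * f y)) =
      fun y => π⁻¹ * (y * Real.exp (-y ^ 2) * f y) := by
    funext y; ring
  rw [this, IntegrableOn, integrable_const_mul_iff (by simp [pi_ne_zero]), IntegrableOn]

/-- Differentiating Euler's integral under the integral sign at s = 1 produces the factor log t, and
Γ'(1) = -γ. -/
theorem integral_log_mul_exp_neg :
    ∫ t in Ioi (0 : ℝ), Real.log t * Real.exp (-t) = -eulerMascheroniConstant := by
  have h1 := Complex.hasDerivAt_GammaIntegral (s := 1) (by simp)
  have h2 : HasDerivAt Complex.GammaIntegral (-(eulerMascheroniConstant : ℂ)) 1 := by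
    refine Complex.hasDerivAt_Gamma_one.congr_of_eventuallyEq ?_
    have : IsOpen {s : ℂ | 0 < s.re} := isOpen_lt continuous_const Complex.continuous_re
    filter_upwards [this.mem_nhds (show (0 : ℝ) < (1 : ℂ).re by simp)] with s hs
    exact (Complex.Gamma_eq_integral hs).symm
  have h3 := h1.unique h2
  simp only [sub_self, Complex.cpow_zero, one_mul] at h3
  have h4 : ∫ t in Ioi (0 : ℝ), ((Real.log t : ℂ) * (Real.exp (-t) : ℂ)) =
      ((∫ t in Ioi (0 : ℝ), Real.log t * Real.exp (-t) : ℝ) : ℂ) := by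
    rw [← integral_complex_ofReal]
    push_cast
    rfl
  rw [h4] at h3
  exact_mod_cast h3

theorem integral_log_norm_complexGaussian :
    ∫ z, Real.log ‖z‖ ∂complexGaussian = -eulerMascheroniConstant / 2 := by
  rw [integral_complexGaussian_norm Real.log]
  -- Substitution t = y²; log t = 2 log y is the source of the factor 1/2.
  have h := integral_comp_rpow_Ioi_of_pos (g := fun t => Real.log t * Real.exp (-t)) two_pos
  rw [integral_log_mul_exp_neg] at h
  rw [← h, ← integral_const_mul, ← integral_div]
  refine setIntegral_congr_fun measurableSet_Ioi fun y (hy : 0 < y) => ?_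
  simp only [smul_eq_mul]
  rw [Real.log_rpow hy, show (2 : ℝ) - 1 = 1 by norm_num, Real.rpow_one, Real.rpow_two]
  ring

theorem integrable_norm_sq_complexGaussian : Integrable (fun z => ‖z‖ ^ 2) complexGaussian := by
  rw [integrable_complexGaussian_norm_iff (fun y => y ^ 2)]
  have h := (integrable_rpow_mul_exp_neg_mul_sq (b := 1) one_pos (s := 3)
    (by norm_num)).integrableOn (s := Ioi 0)
  refine h.congr_fun (fun y (hy : 0 < y) => ?_) measurableSet_Ioi
  dsimp only
  rw [show (3 : ℝ) = (3 : ℕ) by norm_num, Real.rpow_natCast]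
  ring_nf

theorem integral_norm_sq_complexGaussian : ∫ z, ‖z‖ ^ 2 ∂complexGaussian = 1 := by
  rw [integral_complexGaussian_norm (fun y => y ^ 2)]
  have h := integral_rpow_mul_exp_neg_rpow (p := 2) (q := 3) (by norm_num) (by norm_num)
  have h2 : ∫ y in Ioi (0 : ℝ), y * Real.exp (-y ^ 2) * y ^ 2 =
      ∫ y in Ioi (0 : ℝ), y ^ (3 : ℝ) * Real.exp (-y ^ (2 : ℝ)) := by
    refine setIntegral_congr_fun measurableSet_Ioi fun y (hy : 0 < y) => ?_
    rw [show (3 : ℝ) = (3 : ℕ) by norm_num, Real.rpow_natCast, Real.rpow_two]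
    ring
  rw [h2, h]
  norm_num

theorem integrable_norm_complexGaussian : Integrable (fun z => ‖z‖) complexGaussian := by
  refine (integrable_norm_sq_complexGaussian.add (integrable_const (1 : ℝ))).mono'
    (by fun_prop) (ae_of_all _ fun z => ?_)
  simp only [norm_norm, Pi.add_apply]
  nlinarith [sq_nonneg (‖z‖ - 1), norm_nonneg z]

theorem integrable_id_complexGaussian : Integrable (fun z : ℂ => z) complexGaussian :=
  (integrable_norm_iff (by fun_prop)).1 integrable_norm_complexGaussian

theorem integral_id_complexGaussian : ∫ z, z ∂complexGaussian = 0 := by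
  have h := integral_map (μ := complexGaussian) (φ := fun z : ℂ => z * (-1)) (by fun_prop)
    (f := fun z : ℂ => z) (by fun_prop)
  rw [map_mul_complexGaussian (-1) (by simp)] at h
  simp only [mul_neg, mul_one] at h
  rw [integral_neg] at h
  exact CharZero.eq_neg_self_iff.1 h

theorem norm_mul_add_sq (a w z : ℂ) :
    ‖z * a + w‖ ^ 2 = ‖a‖ ^ 2 * ‖z‖ ^ 2 + 2 * (star w * a * z).re + ‖w‖ ^ 2 := by
  simp only [Complex.sq_norm, Complex.normSq_apply, Complex.add_re, Complex.add_im, Complex.mul_re,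
    Complex.mul_im, Complex.star_def, Complex.conj_re, Complex.conj_im]
  ring

theorem integrable_norm_mul_add_sq_complexGaussian (a w : ℂ) :
    Integrable (fun z => ‖z * a + w‖ ^ 2) complexGaussian := by
  simp_rw [norm_mul_add_sq]
  exact ((integrable_norm_sq_complexGaussian.const_mul _).add
    ((integrable_id_complexGaussian.const_mul (star w * a)).re.const_mul 2)).add
    (integrable_const _)

theorem integral_norm_mul_add_sq_complexGaussian (a w : ℂ) :
    ∫ z, ‖z * a + w‖ ^ 2 ∂complexGaussian = ‖a‖ ^ 2 + ‖w‖ ^ 2 := by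
  simp_rw [norm_mul_add_sq]
  have h1 := integrable_norm_sq_complexGaussian.const_mul (‖a‖ ^ 2)
  have h2 := (integrable_id_complexGaussian.const_mul (star w * a)).re.const_mul 2
  have h3 : ∫ z, (star w * a * z).re ∂complexGaussian = 0 := by
    have := integral_re (integrable_id_complexGaussian.const_mul (star w * a))
    rw [integral_const_mul, integral_id_complexGaussian] at this
    simpa using this
  have h4 := integral_add (h1.add h2) (integrable_const (‖w‖ ^ 2))
  have h5 := integral_add h1 h2
  simp only [Pi.add_apply] at h4
  rw [integral_const_mul, integral_const_mul, integral_norm_sq_complexGaussian] at h5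
  refine h4.trans ?_
  have h6 : ∫ z, RCLike.re (star w * a * z) ∂complexGaussian = 0 := h3
  rw [h5, h6]
  simp

/-! ### Logarithmic moment of a shifted Gaussian -/

/-- The logarithmic singularity is dominated by 1/‖w‖, which is locally integrable in the plane. -/
theorem abs_log_norm_le (w : ℂ) :
    |Real.log ‖w‖| ≤ ‖w‖ + 1 + (Iio (1 : ℝ)).indicator (fun y => y⁻¹) ‖w‖ := by
  by_cases h : ‖w‖ < 1
  · rw [indicator_of_mem (by exact h)]
    rcases (norm_nonneg w).eq_or_lt with h0 | h0
    · simp [← h0]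
    · rw [abs_of_nonpos (Real.log_nonpos h0.le h.le), ← Real.log_inv]
      have := Real.log_le_sub_one_of_pos (inv_pos.2 h0)
      linarith
  · rw [indicator_of_notMem (by exact h), abs_of_nonneg (Real.log_nonneg (not_lt.1 h))]
    have := Real.log_le_sub_one_of_pos (lt_of_lt_of_le one_pos (not_lt.1 h))
    linarith

theorem integrable_indicator_inv_norm :
    Integrable (fun w : ℂ => (Iio (1 : ℝ)).indicator (fun y => y⁻¹) ‖w‖) volume := by
  rw [integrable_fun_norm_addHaar (E := ℂ) volume
    (f := (Iio (1 : ℝ)).indicator (fun y => y⁻¹)), Complex.finrank_real_complex]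
  have h : IntegrableOn (fun _ : ℝ => (1 : ℝ)) (Ioo 0 1) volume := by simp
  rw [← integrable_indicator_iff measurableSet_Ioi]
  rw [← integrable_indicator_iff measurableSet_Ioo] at h
  refine h.congr (ae_of_all _ fun y => ?_)
  simp only [indicator, mem_Ioo, mem_Ioi, mem_Iio, Nat.add_one_sub_one, pow_one, smul_eq_mul]
  split_ifs <;> first | rfl | (simp_all; done) | (field_simp)

theorem integrable_log_norm_add_complexGaussian (z : ℂ) :
    Integrable (fun y => Real.log ‖y + z‖) complexGaussian := by
  have h1 := (integrable_indicator_inv_norm.comp_add_right z).mono_measure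
    complexGaussian_le_volume
  have h2 : Integrable (fun y => ‖y‖ + ‖z‖ + 1) complexGaussian :=
    (integrable_norm_complexGaussian.add (integrable_const _)).add (integrable_const _)
  refine (h2.add h1).mono' ?_ (ae_of_all _ fun y => ?_)
  · exact (by fun_prop : Measurable fun y : ℂ => Real.log ‖y + z‖).aestronglyMeasurable
  · rw [Real.norm_eq_abs]
    refine (abs_log_norm_le _).trans ?_
    simp only [Pi.add_apply]
    gcongr
    exact norm_add_le _ _

/-- The antiderivative is grouped around `y * Real.log y`, which is continuous at 0, so that it can
be evaluated at the endpoint 0. -/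
theorem hasDerivAt_mul_log_antideriv (ρ y : ℝ) (hy : 0 < y) :
    HasDerivAt (fun y => (y ^ 2 / 2 - y ^ 4 / 4) * Real.log ρ
      - (y / 2 - y ^ 3 / 4) * (y * Real.log y) + y ^ 2 / 4 - y ^ 4 / 16)
      (y * (1 - y ^ 2) * (Real.log ρ - Real.log y)) y := by
  have hl := Real.hasDerivAt_log hy.ne'
  have hp : ∀ (k : ℕ) (c : ℝ), HasDerivAt (fun y : ℝ => y ^ k / c) (k * y ^ (k - 1) / c) y :=
    fun k c => (hasDerivAt_pow k y).div_const c
  have hy1 := hasDerivAt_id' y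
  have e1 := ((hp 2 2).fun_sub (hp 4 4)).mul_const (Real.log ρ)
  have e2 := ((hy1.div_const 2).fun_sub (hp 3 4)).fun_mul (hy1.fun_mul hl)
  have e3 := ((e1.fun_sub e2).fun_add (hp 2 4)).fun_sub (hp 4 16)
  refine e3.congr_deriv ?_
  push_cast
  field_simp
  ring

theorem intervalIntegral_mul_log (ρ : ℝ) (hρ : 0 < ρ) :
    IntervalIntegrable (fun y => y * (1 - y ^ 2) * (Real.log ρ - Real.log y)) volume 0 ρ ∧
    ∫ y in (0 : ℝ)..ρ, y * (1 - y ^ 2) * (Real.log ρ - Real.log y) =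
      ρ ^ 2 / 4 - ρ ^ 4 / 16 := by
  have hi : IntervalIntegrable (fun y => y * (1 - y ^ 2) * (Real.log ρ - Real.log y))
      volume 0 ρ := by
    have : (fun y => y * (1 - y ^ 2) * (Real.log ρ - Real.log y)) =
        fun y => y * (1 - y ^ 2) * Real.log ρ - (1 - y ^ 2) * (y * Real.log y) := by
      funext y; ring
    rw [this]
    have hc := Real.continuous_mul_log
    exact Continuous.intervalIntegrable (by fun_prop) _ _
  refine ⟨hi, ?_⟩
  have hc := Real.continuous_mul_log
  rw [intervalIntegral.integral_eq_sub_of_hasDerivAt_of_le hρ.le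
    (f := fun y => (y ^ 2 / 2 - y ^ 4 / 4) * Real.log ρ
      - (y / 2 - y ^ 3 / 4) * (y * Real.log y) + y ^ 2 / 4 - y ^ 4 / 16)
    (Continuous.continuousOn (by fun_prop))
    (fun y hy => hasDerivAt_mul_log_antideriv ρ y hy.1) hi]
  ring

theorem integrable_posLog_div_norm_complexGaussian (ρ : ℝ) (hρ : 0 < ρ) :
    Integrable (fun z => Real.posLog (ρ / ‖z‖)) complexGaussian := by
  have h := (integrable_const (μ := complexGaussian) (Real.log ρ)).sub
    (integrable_log_norm_add_complexGaussian 0)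
  refine h.norm.mono' ?_ ?_
  · have hc := Real.continuous_posLog
    exact (hc.measurable.comp (by fun_prop : Measurable fun z : ℂ => ρ / ‖z‖)).aestronglyMeasurable
  · refine ae_of_all _ fun z => ?_
    rw [Real.norm_of_nonneg Real.posLog_nonneg]
    simp only [Pi.sub_apply, add_zero, Real.norm_eq_abs]
    rcases (norm_nonneg z).eq_or_lt with h0 | h0
    · simp [← h0]
    · rw [← Real.log_div hρ.ne' h0.ne', Real.posLog_apply]
      exact max_le (abs_nonneg _) (le_abs_self _)

/-- The integrand lives on ‖z‖ ≤ ρ. Replacing exp(-y²) by its lower bound 1 - y² makes the radial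
integral elementary. -/
theorem le_integral_posLog_div_norm_complexGaussian (ρ : ℝ) (hρ : 0 < ρ) :
    ρ ^ 2 / 2 - ρ ^ 4 / 8 ≤ ∫ z, Real.posLog (ρ / ‖z‖) ∂complexGaussian := by
  have hint := integrable_posLog_div_norm_complexGaussian ρ hρ
  rw [integrable_complexGaussian_norm_iff (fun y => Real.posLog (ρ / y))] at hint
  rw [integral_complexGaussian_norm (fun y => Real.posLog (ρ / y))]
  obtain ⟨hi, hv⟩ := intervalIntegral_mul_log ρ hρ
  have h1 : ∫ y in Ioc (0 : ℝ) ρ, y * Real.exp (-y ^ 2) * Real.posLog (ρ / y) ≤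
      ∫ y in Ioi (0 : ℝ), y * Real.exp (-y ^ 2) * Real.posLog (ρ / y) := by
    refine setIntegral_mono_set hint ?_ (Filter.Eventually.of_forall fun y hy => hy.1)
    rw [Filter.EventuallyLE, ae_restrict_iff' measurableSet_Ioi]
    refine ae_of_all _ fun y (hy : 0 < y) => ?_
    have := Real.posLog_nonneg (x := ρ / y)
    simp only [Pi.zero_apply]
    positivity
  have h2 : ∫ y in Ioc (0 : ℝ) ρ, y * (1 - y ^ 2) * (Real.log ρ - Real.log y) ≤
      ∫ y in Ioc (0 : ℝ) ρ, y * Real.exp (-y ^ 2) * Real.posLog (ρ / y) := by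
    refine setIntegral_mono_on ?_ (hint.mono_set fun y hy => hy.1) measurableSet_Ioc ?_
    · exact (intervalIntegrable_iff_integrableOn_Ioc_of_le hρ.le).1 hi
    · rintro y ⟨hy0, hy1⟩
      have hl : 0 ≤ Real.log ρ - Real.log y := sub_nonneg.2 (Real.log_le_log hy0 hy1)
      have he : 1 - y ^ 2 ≤ Real.exp (-y ^ 2) := by
        linarith [Real.add_one_le_exp (-y ^ 2)]
      have hp : Real.posLog (ρ / y) = Real.log ρ - Real.log y := by
        rw [Real.posLog_apply, Real.log_div hρ.ne' hy0.ne', max_eq_right hl]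
      rw [hp]
      gcongr
  rw [intervalIntegral.integral_of_le hρ.le] at hv
  linarith

/-- Jensen's formula for a linear function on the circle of radius ‖y‖. -/
theorem integral_log_norm_mul_circleMap_add (y z : ℂ) (hy : y ≠ 0) :
    ∫ θ in (0 : ℝ)..2 * π, Real.log ‖y * circleMap 0 1 θ + z‖ =
      2 * π * (Real.log ‖y‖ + Real.posLog (‖z‖ / ‖y‖)) := by
  have h := circleAverage_log_norm_sub_const_eq_log_radius_add_posLog (c := 0) (a := -z)
    (norm_ne_zero_iff.2 hy)
  -- Shifting the angle by arg y turns the circle of radius ‖y‖ into θ ↦ y·exp(iθ).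
  rw [Real.circleAverage_eq_integral_add (Complex.arg y), smul_eq_mul, inv_mul_eq_iff_eq_mul₀
    (by positivity)] at h
  rw [zero_sub, neg_neg, ← div_eq_inv_mul] at h
  rw [← h]
  refine intervalIntegral.integral_congr fun θ _ => ?_
  simp only [sub_neg_eq_add]
  congr 3
  simp only [circleMap, zero_add, Complex.ofReal_one, one_mul, Complex.ofReal_add, add_mul,
    Complex.exp_add]
  conv_lhs => rw [← Complex.norm_mul_exp_arg_mul_I y]
  ring

theorem integral_comp_mul_complexGaussian (f : ℂ → ℝ) (hf : Measurable f) (u : ℂ)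
    (hu : ‖u‖ = 1) :
    ∫ y, f (y * u) ∂complexGaussian = ∫ y, f y ∂complexGaussian := by
  have h := integral_map (μ := complexGaussian) (φ := fun z : ℂ => z * u) (by fun_prop)
    (f := f) hf.aestronglyMeasurable
  rw [map_mul_complexGaussian u hu] at h
  exact h.symm

theorem integrable_comp_mul_complexGaussian (f : ℂ → ℝ) (hf : Integrable f complexGaussian)
    (u : ℂ) (hu : ‖u‖ = 1) : Integrable (fun y => f (y * u)) complexGaussian := by
  have h : Integrable f (complexGaussian.map fun z => z * u) := by
    rwa [map_mul_complexGaussian u hu]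
  exact h.comp_measurable (by fun_prop)

theorem ae_ne_complexGaussian (w : ℂ) : ∀ᵐ y ∂complexGaussian, y ≠ w :=
  (Measure.ae_ne volume w).filter_mono
    (Measure.absolutelyContinuous_of_le complexGaussian_le_volume).ae_le

theorem integrable_log_norm_mul_circleMap_add (z : ℂ) :
    Integrable (fun p : ℝ × ℂ => Real.log ‖p.2 * circleMap 0 1 p.1 + z‖)
      ((volume.restrict (Ioc 0 (2 * π))).prod complexGaussian) := by
  have hm : Measurable fun y : ℂ => ‖Real.log ‖y + z‖‖ := by fun_prop
  have hn : ∀ θ : ℝ, ‖circleMap 0 1 θ‖ = 1 := fun θ => by simp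
  have hp : Measurable fun p : ℝ × ℂ => p.2 * circleMap 0 1 p.1 + z :=
    Continuous.measurable (by fun_prop)
  have h1 : ∀ θ : ℝ, Integrable (fun y => Real.log ‖y * circleMap 0 1 θ + z‖)
      complexGaussian := fun θ =>
    integrable_comp_mul_complexGaussian (fun y => Real.log ‖y + z‖)
      (integrable_log_norm_add_complexGaussian z) _ (hn θ)
  have h2 : (fun θ : ℝ => ∫ y, ‖Real.log ‖y * circleMap 0 1 θ + z‖‖ ∂complexGaussian) =
      fun _ => ∫ y, ‖Real.log ‖y + z‖‖ ∂complexGaussian := funext fun θ =>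
    integral_comp_mul_complexGaussian (fun y => ‖Real.log ‖y + z‖‖) hm _ (hn θ)
  have h3 : Integrable (fun θ : ℝ => ∫ y, ‖Real.log ‖y * circleMap 0 1 θ + z‖‖ ∂complexGaussian)
      (volume.restrict (Ioc 0 (2 * π))) := by
    rw [h2]
    exact integrable_const _
  exact (integrable_prod_iff hp.norm.log.aestronglyMeasurable).2 ⟨ae_of_all _ h1, h3⟩

/-- Rotating y by exp(iθ) does not change the Gaussian. Averaging over θ and exchanging the
integrals reduces the inner one to Jensen's formula. -/
theorem integral_log_norm_add_complexGaussian (z : ℂ) (hz : z ≠ 0) :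
    ∫ y, Real.log ‖y + z‖ ∂complexGaussian =
      -eulerMascheroniConstant / 2 + ∫ y, Real.posLog (‖z‖ / ‖y‖) ∂complexGaussian := by
  have hswap := integral_integral_swap (f := fun (θ : ℝ) (y : ℂ) =>
    Real.log ‖y * circleMap 0 1 θ + z‖) (integrable_log_norm_mul_circleMap_add z)
  have hl : ∀ θ : ℝ, ∫ y, Real.log ‖y * circleMap 0 1 θ + z‖ ∂complexGaussian =
      ∫ y, Real.log ‖y + z‖ ∂complexGaussian := fun θ =>
    integral_comp_mul_complexGaussian (fun y => Real.log ‖y + z‖) (by fun_prop) _ (by simp)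
  simp only [hl] at hswap
  have hr : ∫ y, (∫ θ in Ioc 0 (2 * π), Real.log ‖y * circleMap 0 1 θ + z‖) ∂complexGaussian =
      ∫ y, 2 * π * (Real.log ‖y + 0‖ + Real.posLog (‖z‖ / ‖y‖)) ∂complexGaussian := by
    refine integral_congr_ae ?_
    filter_upwards [ae_ne_complexGaussian 0] with y hy
    rw [← intervalIntegral.integral_of_le (by positivity), add_zero,
      integral_log_norm_mul_circleMap_add y z hy]
  rw [hr, integral_const_mul, integral_add (integrable_log_norm_add_complexGaussian 0)
    (integrable_posLog_div_norm_complexGaussian _ (norm_pos_iff.2 hz))] at hswap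
  simp only [add_zero, integral_log_norm_complexGaussian, integral_const, smul_eq_mul,
    measureReal_restrict_apply_univ, Real.volume_real_Ioc, sub_zero] at hswap
  rw [max_eq_left (by positivity)] at hswap
  exact mul_left_cancel₀ (by positivity) hswap

theorem le_integral_log_norm_add_complexGaussian (z : ℂ) :
    -eulerMascheroniConstant / 2 + ‖z‖ ^ 2 / 2 - ‖z‖ ^ 4 / 8 ≤
      ∫ y, Real.log ‖y + z‖ ∂complexGaussian := by
  rcases eq_or_ne z 0 with rfl | hz
  · simp [integral_log_norm_complexGaussian]
  · rw [integral_log_norm_add_complexGaussian z hz]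
    have := le_integral_posLog_div_norm_complexGaussian ‖z‖ (norm_pos_iff.2 hz)
    linarith

/-! ### Moments of linear forms in fourth roots of unity -/

theorem sum_fourthRoot_norm_sq (w c : ℂ) :
    ∑ k : Fin 4, ‖Complex.I ^ (k : ℕ) * c + w‖ ^ 2 = 4 * (‖c‖ ^ 2 + ‖w‖ ^ 2) := by
  simp only [Complex.sq_norm, Complex.normSq_apply, Fin.sum_univ_four]
  simp [pow_succ]
  ring

/-- For a uniform fourth root u both E u and E u² vanish, so the fourth moment is the same as for a
uniform phase while the average stays a finite sum. -/
theorem sum_fourthRoot_norm_pow_four (w c : ℂ) :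
    ∑ k : Fin 4, ‖Complex.I ^ (k : ℕ) * c + w‖ ^ 4 =
      4 * (‖c‖ ^ 4 + 4 * ‖c‖ ^ 2 * ‖w‖ ^ 2 + ‖w‖ ^ 4) := by
  have h : ∀ z : ℂ, ‖z‖ ^ 4 = (‖z‖ ^ 2) ^ 2 := fun z => by ring
  simp only [h, Complex.sq_norm, Complex.normSq_apply, Fin.sum_univ_four]
  simp [pow_succ]
  ring

theorem sum_fin_succ_fun {m : ℕ} {α : Type*} [Fintype α] (F : (Fin (m + 1) → α) → ℝ) :
    ∑ u, F u = ∑ u : Fin m → α, ∑ a : α, F (Fin.cons a u) := by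
  rw [← (Fin.consEquiv fun _ : Fin (m + 1) => α).sum_comp, Fintype.sum_prod_type_right]
  rfl

/-- Second moment of a linear form in independent uniform fourth roots of unity. -/
theorem sum_fourthRoots_norm_sq {m : ℕ} (c : Fin m → ℂ) :
    ∑ u : Fin m → Fin 4, ‖∑ j, Complex.I ^ (u j : ℕ) * c j‖ ^ 2 =
      4 ^ m * ∑ j, ‖c j‖ ^ 2 := by
  induction m with
  | zero => simp
  | succ m ih =>
    rw [sum_fin_succ_fun]
    simp only [Fin.sum_univ_succ (n := m), Fin.cons_zero, Fin.cons_succ]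
    simp only [sum_fourthRoot_norm_sq, ← Finset.mul_sum,
      Finset.sum_add_distrib, ih]
    simp
    ring

/-- Fourth moment of a linear form in independent uniform fourth roots of unity. -/
theorem sum_fourthRoots_norm_pow_four {m : ℕ} (c : Fin m → ℂ) :
    ∑ u : Fin m → Fin 4, ‖∑ j, Complex.I ^ (u j : ℕ) * c j‖ ^ 4 =
      4 ^ m * (2 * (∑ j, ‖c j‖ ^ 2) ^ 2 - ∑ j, ‖c j‖ ^ 4) := by
  induction m with
  | zero => simp
  | succ m ih =>
    rw [sum_fin_succ_fun]
    have h2 := sum_fourthRoots_norm_sq fun j => c j.succ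
    simp only [Fin.sum_univ_succ (n := m), Fin.cons_zero, Fin.cons_succ]
    simp only [sum_fourthRoot_norm_pow_four, ← Finset.mul_sum, Finset.sum_add_distrib, ih, h2]
    simp
    ring

/-! ### Cauchy–Schwarz bound for the permanent -/

/-- Every permutation contributes the same product: for fixed σ, the sum over `f` factors into the
linear forms in permuted order. -/
theorem sum_permanent_submatrix_mul {n d : ℕ} (V : Matrix (Fin n) (Fin d) ℂ) (x : Fin d → ℂ) :
    ∑ f : Fin n → Fin d, (V.submatrix id f).permanent * ∏ i, star (x (f i)) =
      (n.factorial : ℂ) * ∏ i, star x ⬝ᵥ V i := by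
  simp only [Matrix.permanent, Finset.sum_mul, Matrix.submatrix_apply, id_eq,
    ← Finset.prod_mul_distrib]
  rw [Finset.sum_comm]
  have h : ∀ σ : Equiv.Perm (Fin n),
      ∑ f : Fin n → Fin d, ∏ i, V (σ i) (f i) * star (x (f i)) = ∏ i, star x ⬝ᵥ V i := by
    intro σ
    rw [← Equiv.prod_comp σ]
    simp only [dotProduct, Pi.star_apply, Finset.prod_univ_sum, Fintype.piFinset_univ]
    simp only [mul_comm]
  simp only [h, Finset.sum_const, Finset.card_univ, Fintype.card_perm, Fintype.card_fin,
    nsmul_eq_mul]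

/-- A Cauchy–Binet identity: in the double sum over permutations, summing over `f` yields entries of
V V†, and each fixed σ gives its permanent with permuted rows. -/
theorem sum_norm_permanent_submatrix_sq {n d : ℕ} (V : Matrix (Fin n) (Fin d) ℂ) :
    ((∑ f : Fin n → Fin d, ‖(V.submatrix id f).permanent‖ ^ 2 : ℝ) : ℂ) =
      (n.factorial : ℂ) * (V * Vᴴ).permanent := by
  push_cast
  have h1 : ∀ z : ℂ, (‖z‖ : ℂ) ^ 2 = z * star z := fun z => by
    rw [Complex.star_def, Complex.mul_conj, Complex.normSq_eq_norm_sq]; push_cast; rfl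
  have h2 : ∀ f : Fin n → Fin d, ((‖(V.submatrix id f).permanent‖ : ℂ) ^ 2) =
      ∑ τ : Equiv.Perm (Fin n), ∑ σ : Equiv.Perm (Fin n),
        ∏ i, V (τ i) (f i) * star (V (σ i) (f i)) := by
    intro f
    rw [h1]
    simp only [Matrix.permanent, star_sum, star_prod, Finset.sum_mul_sum,
      Matrix.submatrix_apply, id_eq, Finset.prod_mul_distrib]
  simp only [h2]
  rw [Finset.sum_comm]
  simp only [Finset.sum_comm (s := (Finset.univ : Finset (Fin n → Fin d)))]
  rw [Finset.sum_comm]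
  have h3 : ∀ σ : Equiv.Perm (Fin n), ∑ τ : Equiv.Perm (Fin n), ∑ f : Fin n → Fin d,
      ∏ i, V (τ i) (f i) * star (V (σ i) (f i)) = (V * Vᴴ).permanent := by
    intro σ
    rw [← Matrix.permanent_permute_rows σ (V * Vᴴ)]
    simp only [Matrix.permanent, Matrix.submatrix_apply, id_eq, Matrix.mul_apply,
      Matrix.conjTranspose_apply, Finset.prod_univ_sum, Fintype.piFinset_univ]
  simp only [h3, Finset.sum_const, Finset.card_univ, Fintype.card_perm, Fintype.card_fin,
    nsmul_eq_mul]

theorem permanent_mul_conjTranspose_eq {n d : ℕ} (V : Matrix (Fin n) (Fin d) ℂ) :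
    (V * Vᴴ).permanent =
      (((∑ f : Fin n → Fin d, ‖(V.submatrix id f).permanent‖ ^ 2) / n.factorial : ℝ) : ℂ) := by
  have h := sum_norm_permanent_submatrix_sq V
  have hn : (n.factorial : ℂ) ≠ 0 := by exact_mod_cast n.factorial_ne_zero
  rw [Complex.ofReal_div, h, Complex.ofReal_natCast, mul_div_cancel_left₀ _ hn]

theorem factorial_mul_linearFormsProd_le {n d : ℕ} (V : Matrix (Fin n) (Fin d) ℂ)
    (x : Fin d → ℂ) :
    (n.factorial : ℝ) ^ 2 * linearFormsProd V x ≤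
      (∑ f : Fin n → Fin d, ‖(V.submatrix id f).permanent‖ ^ 2) * (∑ k, ‖x k‖ ^ 2) ^ n := by
  have h := congrArg norm (sum_permanent_submatrix_mul V x)
  rw [norm_mul, Complex.norm_natCast, norm_prod] at h
  have h1 : (n.factorial : ℝ) * ∏ i, ‖star x ⬝ᵥ V i‖ ≤
      ∑ f : Fin n → Fin d, ‖(V.submatrix id f).permanent‖ * ∏ i, ‖x (f i)‖ := by
    rw [← h]
    refine (norm_sum_le _ _).trans (le_of_eq ?_)
    simp only [norm_mul, norm_prod, norm_star]
  have h2 : (∑ k, ‖x k‖ ^ 2) ^ n = ∑ f : Fin n → Fin d, (∏ i, ‖x (f i)‖) ^ 2 := by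
    have := Finset.prod_univ_sum (fun _ : Fin n => (Finset.univ : Finset (Fin d)))
      (fun _ k => ‖x k‖ ^ 2)
    simpa [Fintype.piFinset_univ, Finset.prod_pow] using this
  calc (n.factorial : ℝ) ^ 2 * linearFormsProd V x
      = ((n.factorial : ℝ) * ∏ i, ‖star x ⬝ᵥ V i‖) ^ 2 := by
        rw [linearFormsProd, Finset.prod_pow, mul_pow]
    _ ≤ (∑ f : Fin n → Fin d, ‖(V.submatrix id f).permanent‖ * ∏ i, ‖x (f i)‖) ^ 2 := by
        gcongr
    _ ≤ _ := by rw [h2]; exact Finset.sum_mul_sq_le_sq_mul_sq _ _ _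

theorem sum_norm_sq_of_expNorm_eq_one {d : ℕ} (hd : 0 < d) {x : Fin d → ℂ} (hx : expNorm x = 1) :
    ∑ k, ‖x k‖ ^ 2 = (d : ℝ) := by
  have h : (∑ k, ‖x k‖ ^ 2) / (d : ℝ) = 1 := Real.sqrt_eq_one.1 hx
  rwa [div_eq_one_iff_eq (by positivity)] at h

theorem exp_neg_mul_r_le_permanent {n : ℕ} (hn : 0 < n) (V : Matrix (Fin n) (Fin n) ℂ) :
    ((Real.exp (-(n : ℝ)) * r V : ℝ) : ℂ) ≤ (V * Vᴴ).permanent := by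
  rw [permanent_mul_conjTranspose_eq, Complex.real_le_real]
  obtain ⟨x, hx, hr⟩ := (isGreatest_r hn V).1
  have h := factorial_mul_linearFormsProd_le V x
  rw [sum_norm_sq_of_expNorm_eq_one hn hx, hr] at h
  have hf : (0 : ℝ) < n.factorial := by positivity
  -- nⁿ/n! is a single term of the series of eⁿ.
  have he := Real.pow_div_factorial_le_exp (x := n) (by positivity) n
  rw [div_le_iff₀ hf] at he
  have hS : 0 ≤ ∑ f : Fin n → Fin n, ‖(V.submatrix id f).permanent‖ ^ 2 := by positivity
  have h2 : (n.factorial : ℝ) * r V ≤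
      (∑ f : Fin n → Fin n, ‖(V.submatrix id f).permanent‖ ^ 2) * Real.exp n := by
    refine le_of_mul_le_mul_left ?_ hf
    calc _ = (n.factorial : ℝ) ^ 2 * r V := by ring
      _ ≤ _ := h
      _ ≤ _ * (Real.exp n * n.factorial) := by gcongr
      _ = _ := by ring
  rw [le_div_iff₀ hf, Real.exp_neg, inv_mul_eq_div, div_mul_eq_mul_div,
    div_le_iff₀ (Real.exp_pos _), mul_comm (r V)]
  exact h2

/-! ### Linear forms of a Gaussian vector -/

section PiGaussian

variable {ι : Type*} [Fintype ι]

theorem integrable_comp_sum_mul_pi_complexGaussian {f : ℂ → ℝ} (hf : Integrable f complexGaussian)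
    {b : ι → ℂ} (hb : ∑ i, ‖b i‖ ^ 2 = 1) :
    Integrable (fun g : ι → ℂ => f (∑ i, g i * b i)) (Measure.pi fun _ => complexGaussian) := by
  have hm : Measurable fun g : ι → ℂ => ∑ i, g i * b i := by fun_prop
  rw [← map_sum_mul_pi_complexGaussian b hb] at hf
  exact hf.comp_measurable hm

theorem integral_comp_sum_mul_pi_complexGaussian {f : ℂ → ℝ} (hf : Measurable f)
    {b : ι → ℂ} (hb : ∑ i, ‖b i‖ ^ 2 = 1) :
    ∫ g : ι → ℂ, f (∑ i, g i * b i) ∂(Measure.pi fun _ => complexGaussian) =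
      ∫ y, f y ∂complexGaussian := by
  have hm : Measurable fun g : ι → ℂ => ∑ i, g i * b i := by fun_prop
  rw [← integral_map hm.aemeasurable hf.aestronglyMeasurable, map_sum_mul_pi_complexGaussian b hb]

theorem ae_sum_mul_add_ne_zero {b : ι → ℂ} (hb : ∑ i, ‖b i‖ ^ 2 = 1) (z : ℂ) :
    ∀ᵐ g : ι → ℂ ∂(Measure.pi fun _ => complexGaussian), ∑ i, g i * b i + z ≠ 0 := by
  have hm : Measurable fun g : ι → ℂ => ∑ i, g i * b i := by fun_prop
  have h := ae_ne_complexGaussian (-z)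
  rw [← map_sum_mul_pi_complexGaussian b hb] at h
  filter_upwards [ae_of_ae_map hm.aemeasurable h] with g hg h0
  exact hg (eq_neg_of_add_eq_zero_left h0)

theorem log_norm_mul_add_ae_eq {σ : ℝ} (hσ : 0 < σ) {b : ι → ℂ} (hb : ∑ i, ‖b i‖ ^ 2 = 1)
    (z : ℂ) :
    ∀ᵐ g : ι → ℂ ∂(Measure.pi fun _ => complexGaussian),
      σ * ∑ i, g i * b i + z ≠ 0 ∧
      Real.log ‖σ * ∑ i, g i * b i + z‖ =
        Real.log σ + Real.log ‖∑ i, g i * b i + z / σ‖ := by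
  have hσ' : (σ : ℂ) ≠ 0 := by exact_mod_cast hσ.ne'
  filter_upwards [ae_sum_mul_add_ne_zero hb (z / σ)] with g hg
  have h : (σ : ℂ) * ∑ i, g i * b i + z = σ * (∑ i, g i * b i + z / σ) := by
    field_simp
  rw [h]
  refine ⟨mul_ne_zero hσ' hg, ?_⟩
  rw [norm_mul, Real.log_mul (norm_ne_zero_iff.2 hσ') (norm_ne_zero_iff.2 hg), Complex.norm_real,
    Real.norm_of_nonneg hσ.le]

theorem integrable_log_norm_mul_sum_add {σ : ℝ} (hσ : 0 < σ) {b : ι → ℂ}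
    (hb : ∑ i, ‖b i‖ ^ 2 = 1) (z : ℂ) :
    Integrable (fun g : ι → ℂ => Real.log ‖σ * ∑ i, g i * b i + z‖)
      (Measure.pi fun _ => complexGaussian) := by
  have h := integrable_comp_sum_mul_pi_complexGaussian
    (integrable_log_norm_add_complexGaussian (z / σ)) hb
  refine ((integrable_const (Real.log σ)).add h).congr ?_
  filter_upwards [log_norm_mul_add_ae_eq hσ hb z] with g hg
  exact hg.2.symm

theorem le_integral_log_norm_mul_sum_add {σ : ℝ} (hσ : 0 < σ) {b : ι → ℂ}
    (hb : ∑ i, ‖b i‖ ^ 2 = 1) (z : ℂ) :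
    Real.log σ - eulerMascheroniConstant / 2 + ‖z‖ ^ 2 / σ ^ 2 / 2 - ‖z‖ ^ 4 / σ ^ 4 / 8 ≤
      ∫ g : ι → ℂ, Real.log ‖σ * ∑ i, g i * b i + z‖
        ∂(Measure.pi fun _ => complexGaussian) := by
  have h := integrable_comp_sum_mul_pi_complexGaussian
    (integrable_log_norm_add_complexGaussian (z / σ)) hb
  have h1 : ∫ g : ι → ℂ, Real.log ‖σ * ∑ i, g i * b i + z‖
      ∂(Measure.pi fun _ => complexGaussian) =
      ∫ g : ι → ℂ, (Real.log σ + Real.log ‖∑ i, g i * b i + z / σ‖)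
        ∂(Measure.pi fun _ => complexGaussian) := by
    refine integral_congr_ae ?_
    filter_upwards [log_norm_mul_add_ae_eq hσ hb z] with g hg
    exact hg.2
  rw [h1, integral_add (integrable_const _) h, integral_const, probReal_univ, one_smul,
    integral_comp_sum_mul_pi_complexGaussian (f := fun y => Real.log ‖y + z / σ‖)
      (by fun_prop) hb]
  have h2 := le_integral_log_norm_add_complexGaussian (z / σ)
  rw [norm_div, Complex.norm_real, Real.norm_of_nonneg hσ.le, div_pow, div_pow] at h2
  linarith

theorem integrable_and_integral_norm_mul_sum_add_sq (a : ℂ) (b : ι → ℂ) (w : ℂ) :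
    Integrable (fun g : ι → ℂ => ‖a * ∑ i, g i * b i + w‖ ^ 2)
      (Measure.pi fun _ => complexGaussian) ∧
    ∫ g : ι → ℂ, ‖a * ∑ i, g i * b i + w‖ ^ 2 ∂(Measure.pi fun _ => complexGaussian) =
      ‖a‖ ^ 2 * ∑ i, ‖b i‖ ^ 2 + ‖w‖ ^ 2 := by
  -- A zero coefficient vector cannot be normalized, so it is treated apart; otherwise its norm ρ is
  -- absorbed into a.
  rcases eq_or_ne (∑ i, ‖b i‖ ^ 2) 0 with h0 | h0
  · have hb : ∀ i, b i = 0 := fun i => by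
      have := (Finset.sum_eq_zero_iff_of_nonneg fun i _ => by positivity).1 h0 i
        (Finset.mem_univ i)
      simpa using this
    simp [hb]
  · set ρ := Real.sqrt (∑ i, ‖b i‖ ^ 2) with hρ
    have hρ2 : ρ ^ 2 = ∑ i, ‖b i‖ ^ 2 := Real.sq_sqrt (by positivity)
    have hρ0 : ρ ≠ 0 := fun h => h0 (by rw [← hρ2, h]; ring)
    have hρ' : (ρ : ℂ) ≠ 0 := by exact_mod_cast hρ0
    have hb : ∑ i, ‖b i / ρ‖ ^ 2 = 1 := by
      simp only [norm_div, div_pow, Complex.norm_real, Real.norm_eq_abs, sq_abs]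
      rw [← Finset.sum_div, hρ2, div_self h0]
    have h1 : (fun g : ι → ℂ => ‖a * ∑ i, g i * b i + w‖ ^ 2) =
        fun g => ‖(∑ i, g i * (b i / ρ)) * (a * ρ) + w‖ ^ 2 := by
      funext g
      have : ∑ i, g i * (b i / ρ) = (∑ i, g i * b i) / ρ := by
        rw [Finset.sum_div]
        exact Finset.sum_congr rfl fun i _ => by ring
      rw [this]
      congr 3
      field_simp
    rw [h1]
    refine ⟨integrable_comp_sum_mul_pi_complexGaussian
      (integrable_norm_mul_add_sq_complexGaussian (a * ρ) w) hb, ?_⟩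
    rw [integral_comp_sum_mul_pi_complexGaussian (f := fun y => ‖y * (a * ρ) + w‖ ^ 2)
      (by fun_prop) hb, integral_norm_mul_add_sq_complexGaussian, norm_mul, mul_pow,
      Complex.norm_real, Real.norm_eq_abs, sq_abs, hρ2]

end PiGaussian

/-! ### Rounding random vectors to the sphere -/

theorem linearFormsProd_le_r {n : ℕ} (hn : 0 < n) (V : Matrix (Fin n) (Fin n) ℂ) (x : Fin n → ℂ)
    (hx : 0 < ∑ k, ‖x k‖ ^ 2) :
    (n / ∑ k, ‖x k‖ ^ 2) ^ n * linearFormsProd V x ≤ r V := by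
  set N := ∑ k, ‖x k‖ ^ 2 with hN
  have hn' : (0 : ℝ) < n := by exact_mod_cast hn
  have hc : Real.sqrt (n / N) ^ 2 = n / N := Real.sq_sqrt (by positivity)
  have h1 : expNorm ((Real.sqrt (n / N) : ℂ) • x) = 1 := by
    rw [expNorm, Real.sqrt_eq_one]
    simp only [Pi.smul_apply, smul_eq_mul, norm_mul, mul_pow, Complex.norm_real, Real.norm_eq_abs,
      sq_abs, hc]
    rw [← Finset.mul_sum, ← hN]
    field_simp
  have h2 := (isGreatest_r hn V).2 ⟨_, h1, rfl⟩
  have h3 : linearFormsProd V ((Real.sqrt (n / N) : ℂ) • x) = (n / N) ^ n * linearFormsProd V x := by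
    simp only [linearFormsProd, star_smul, smul_dotProduct, smul_eq_mul, norm_mul, norm_star, mul_pow,
      Complex.norm_real, Real.norm_eq_abs, sq_abs, hc, Finset.prod_mul_distrib, Finset.prod_const,
      Finset.card_univ, Fintype.card_fin]
  rwa [h3] at h2

/-- The bound log t ≤ t - 1 at t = ‖y‖²/n makes the cost of rescaling linear in ‖y‖², so only a
second moment is needed once y is random. -/
theorem sum_log_norm_le_log_r {n : ℕ} (hn : 0 < n) (V : Matrix (Fin n) (Fin n) ℂ)
    (y : Fin n → ℂ) (hy : ∀ i, y ⬝ᵥ V i ≠ 0) :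
    0 < r V ∧ ∑ i, 2 * Real.log ‖y ⬝ᵥ V i‖ - (∑ k, ‖y k‖ ^ 2 - n) ≤ Real.log (r V) := by
  have hn' : (0 : ℝ) < n := by exact_mod_cast hn
  have hN : 0 < ∑ k, ‖y k‖ ^ 2 := by
    refine lt_of_le_of_ne (by positivity) fun h => hy ⟨0, hn⟩ ?_
    have hb : y = 0 := funext fun i => by
      have := (Finset.sum_eq_zero_iff_of_nonneg fun i _ => by positivity).1 h.symm i
        (Finset.mem_univ i)
      simpa using this
    simp [hb]
  have h := linearFormsProd_le_r hn V (star y) (by simpa using hN)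
  simp only [Pi.star_apply, norm_star] at h
  have hP : 0 < linearFormsProd V (star y) := by
    simp only [linearFormsProd, star_star]
    exact Finset.prod_pos fun i _ => by have := norm_pos_iff.2 (hy i); positivity
  have hr : 0 < r V := lt_of_lt_of_le (by positivity) h
  refine ⟨hr, ?_⟩
  have hl := Real.log_le_log (by positivity) h
  rw [Real.log_mul (by positivity) hP.ne', Real.log_pow] at hl
  have h2 : Real.log (linearFormsProd V (star y)) = ∑ i, 2 * Real.log ‖y ⬝ᵥ V i‖ := by
    simp only [linearFormsProd, star_star]
    rw [Real.log_prod fun i _ => by have := norm_pos_iff.2 (hy i); positivity]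
    exact Finset.sum_congr rfl fun i _ => by rw [Real.log_pow]; norm_num
  have h3 := Real.log_le_sub_one_of_pos (x := (∑ k, ‖y k‖ ^ 2) / n) (by positivity)
  rw [← inv_div, Real.log_inv] at h3
  have h4 : (n : ℝ) * ((n / ∑ k, ‖y k‖ ^ 2)⁻¹ - 1) = ∑ k, ‖y k‖ ^ 2 - n := by
    rw [inv_div]; field_simp
  have h5 := mul_le_mul_of_nonneg_left h3 hn'.le
  rw [h4] at h5
  linarith

/-- Gaussian rounding with a deterministic shift: the vector `σ (g ᵥ* B) + w`, for a standard complex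
Gaussian `g`, bounds `log (r V)` from below. -/
theorem gaussian_rounding_le_log_r {n : ℕ} (hn : 0 < n) (V B : Matrix (Fin n) (Fin n) ℂ)
    (hB : ∀ i, ∑ l, ‖(B *ᵥ V i) l‖ ^ 2 = 1) {σ : ℝ} (hσ : 0 < σ) (w : Fin n → ℂ) :
    0 < r V ∧
    ∑ i, (2 * Real.log σ - eulerMascheroniConstant + ‖w ⬝ᵥ V i‖ ^ 2 / σ ^ 2
        - ‖w ⬝ᵥ V i‖ ^ 4 / σ ^ 4 / 4)
      - (∑ k, (σ ^ 2 * ∑ l, ‖B l k‖ ^ 2 + ‖w k‖ ^ 2) - n) ≤ Real.log (r V) := by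
  let y : (Fin n → ℂ) → Fin n → ℂ := fun g k => σ * ∑ l, g l * B l k + w k
  let μ : Measure (Fin n → ℂ) := Measure.pi fun _ => complexGaussian
  have hy : ∀ g i, y g ⬝ᵥ V i = σ * ∑ l, g l * (B *ᵥ V i) l + w ⬝ᵥ V i := by
    intro g i
    have h1 : y g = (σ : ℂ) • (g ᵥ* B) + w := by
      funext k
      simp [y, Matrix.vecMul, dotProduct]
    rw [h1, add_dotProduct, smul_dotProduct, ← Matrix.dotProduct_mulVec]
    rfl
  have hae : ∀ᵐ g ∂μ, ∀ i, y g ⬝ᵥ V i ≠ 0 := by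
    rw [ae_all_iff]
    intro i
    filter_upwards [log_norm_mul_add_ae_eq hσ (hB i) (w ⬝ᵥ V i)] with g hg
    rw [hy]
    exact hg.1
  have hr : 0 < r V := by
    -- An almost sure event of a probability measure has a witness.
    obtain ⟨g, hg⟩ := hae.exists
    exact (sum_log_norm_le_log_r hn V (y g) hg).1
  refine ⟨hr, ?_⟩
  have hi1 : ∀ i, Integrable (fun g => 2 * Real.log ‖y g ⬝ᵥ V i‖) μ := fun i => by
    simp only [hy]
    exact (integrable_log_norm_mul_sum_add hσ (hB i) _).const_mul 2
  have hi2 : ∀ k, Integrable (fun g => ‖y g k‖ ^ 2) μ := fun k =>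
    (integrable_and_integral_norm_mul_sum_add_sq σ (fun l => B l k) (w k)).1
  have hi3 : Integrable (fun g => ∑ i, 2 * Real.log ‖y g ⬝ᵥ V i‖) μ :=
    integrable_finsetSum _ fun i _ => hi1 i
  have hi4 : Integrable (fun g => ∑ k, ‖y g k‖ ^ 2) μ :=
    integrable_finsetSum _ fun k _ => hi2 k
  have hmono : ∫ g, (∑ i, 2 * Real.log ‖y g ⬝ᵥ V i‖ - (∑ k, ‖y g k‖ ^ 2 - n)) ∂μ ≤
      ∫ _, Real.log (r V) ∂μ := by
    refine integral_mono_ae (hi3.sub (hi4.sub (integrable_const (n : ℝ)))) (integrable_const _) ?_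
    filter_upwards [hae] with g hg
    exact (sum_log_norm_le_log_r hn V (y g) hg).2
  have hi5 : Integrable (fun g => ∑ k, ‖y g k‖ ^ 2 - (n : ℝ)) μ := hi4.sub (integrable_const _)
  rw [integral_sub hi3 hi5, integral_sub hi4 (integrable_const _),
    integral_finsetSum _ fun i _ => hi1 i, integral_finsetSum _ fun k _ => hi2 k,
    integral_const, integral_const, probReal_univ, one_smul, one_smul] at hmono
  refine le_trans ?_ hmono
  have e1 : ∀ k, ∫ g, ‖y g k‖ ^ 2 ∂μ = σ ^ 2 * ∑ l, ‖B l k‖ ^ 2 + ‖w k‖ ^ 2 := fun k => by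
    rw [(integrable_and_integral_norm_mul_sum_add_sq σ (fun l => B l k) (w k)).2,
      Complex.norm_real, Real.norm_eq_abs, sq_abs]
  simp only [e1]
  gcongr with i
  simp only [hy]
  rw [integral_const_mul]
  have := le_integral_log_norm_mul_sum_add hσ (hB i) (w ⬝ᵥ V i)
  linarith

/-! ### Factoring X and consequences of A ⪯ I -/

open scoped MatrixOrder Matrix.Norms.L2Operator in
theorem exists_eq_conjTranspose_mul_self {n : ℕ} {X : Matrix (Fin n) (Fin n) ℂ}
    (hX : X.PosSemidef) : ∃ B : Matrix (Fin n) (Fin n) ℂ, X = Bᴴ * B :=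
  CStarAlgebra.nonneg_iff_eq_star_mul_self.mp hX.nonneg

theorem trace_conjTranspose_mul_self_eq {m n : ℕ} (B : Matrix (Fin m) (Fin n) ℂ) :
    (Bᴴ * B).trace = ((∑ k, ∑ l, ‖B l k‖ ^ 2 : ℝ) : ℂ) := by
  simp only [Matrix.trace, Matrix.diag_apply, Matrix.mul_apply, Matrix.conjTranspose_apply]
  push_cast
  refine Finset.sum_congr rfl fun k _ => Finset.sum_congr rfl fun l _ => ?_
  rw [Complex.star_def, mul_comm, Complex.mul_conj, Complex.normSq_eq_norm_sq]
  push_cast; rfl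

theorem rowForm_conjTranspose_mul_self {n : ℕ} (V B : Matrix (Fin n) (Fin n) ℂ) (i : Fin n) :
    rowForm V (Bᴴ * B) i = ((∑ l, ‖(B *ᵥ V i) l‖ ^ 2 : ℝ) : ℂ) := by
  rw [rowForm, ← Matrix.mulVec_mulVec, Matrix.dotProduct_mulVec, ← Matrix.star_mulVec]
  push_cast
  refine Finset.sum_congr rfl fun l _ => ?_
  rw [Pi.star_apply, Complex.star_def, mul_comm, Complex.mul_conj, Complex.normSq_eq_norm_sq]
  push_cast; rfl

theorem posSemidef_sub_mul_self {n : ℕ} {A : Matrix (Fin n) (Fin n) ℂ} (hA : A.PosSemidef)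
    (hAI : (1 - A).PosSemidef) : (A - A * A).PosSemidef := by
  have h1 := hAI.mul_mul_conjTranspose_same A
  have h2 := hA.mul_mul_conjTranspose_same (1 - A)
  rw [hA.isHermitian.eq] at h1
  rw [hAI.isHermitian.eq] at h2
  have h3 := h1.add h2
  -- Writing A - A² as a sum of two congruences of positive semidefinite matrices avoids spectral
  -- calculus.
  have : A * (1 - A) * A + (1 - A) * A * (1 - A) = A - A * A := by noncomm_ring
  rwa [this] at h3

theorem sum_norm_sq_row_le {n : ℕ} {A : Matrix (Fin n) (Fin n) ℂ} (hA : A.PosSemidef)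
    (hAI : (1 - A).PosSemidef) (i : Fin n) : ∑ j, ‖A i j‖ ^ 2 ≤ (A i i).re := by
  have h := (posSemidef_sub_mul_self hA hAI).diag_nonneg (i := i)
  have h2 : (A * A) i i = ((∑ j, ‖A i j‖ ^ 2 : ℝ) : ℂ) := by
    rw [Matrix.mul_apply]
    push_cast
    refine Finset.sum_congr rfl fun j _ => ?_
    rw [← hA.isHermitian.apply j i, Complex.star_def, Complex.mul_conj, Complex.normSq_eq_norm_sq]
    push_cast; rfl
  rw [Matrix.sub_apply, h2, Complex.le_def] at h
  have := h.1
  simp only [Complex.zero_re, Complex.sub_re, Complex.ofReal_re] at this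
  linarith

/-- Monotonicity in q and f reduces to q = a, f = a⁴. The maximum of 2a - a³ over a ≥ 0 is
(4/3)√(2/3) ≈ 1.0887, just below 1.092. -/
theorem two_mul_sq_sub_pow_four_le {a q f : ℝ} (ha0 : 0 ≤ a) (hq0 : 0 ≤ q) (hq : q ≤ a)
    (hf : a ^ 4 ≤ f) : 2 * q ^ 2 - f ≤ 1.092 * a := by
  have h1 : 2 * a ^ 2 - a ^ 4 ≤ 1.092 * a := by
    -- 0.8165 approximates the maximizer √(2/3), nearly a double root of a³ - 2a + 1.0887, and 1.633
    -- is its double. The small terms absorb rounding.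
    have h : 0 ≤ a * ((a - 0.8165) ^ 2 * (a + 1.633) + 0.00001 * a + 0.003) := by positivity
    nlinarith [sq_nonneg a]
  nlinarith

theorem add_mul_sub_mul_le {a q f κ : ℝ} (L : ℝ) (hκ : 0 ≤ κ) (ha0 : 0 ≤ a) (haq : a ^ 2 ≤ q)
    (hq : q ≤ a) (hf : a ^ 4 ≤ f) :
    L + κ * a ^ 2 - κ ^ 2 * 0.273 * a ≤ L + κ * q - κ ^ 2 / 4 * (2 * q ^ 2 - f) := by
  have h5 := two_mul_sq_sub_pow_four_le ha0 ((sq_nonneg a).trans haq) hq hf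
  have h6 := mul_le_mul_of_nonneg_left h5 (show 0 ≤ κ ^ 2 / 4 by positivity)
  have h7 := mul_le_mul_of_nonneg_left haq hκ
  linarith

/-! ### Averaging over shifts and choosing the parameters -/

/-- The rounding bound averaged over shifts by independent uniform fourth roots of unity. -/
theorem le_log_r {n : ℕ} (hn : 0 < n) (V B : Matrix (Fin n) (Fin n) ℂ)
    (hB : ∀ i, ∑ l, ‖(B *ᵥ V i) l‖ ^ 2 = 1) {σ : ℝ} (hσ : 0 < σ) (c : ℝ) :
    0 < r V ∧
    ∑ i, (2 * Real.log σ - eulerMascheroniConstant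
        + c ^ 2 / σ ^ 2 * ∑ j, ‖(V * Vᴴ) i j‖ ^ 2
        - (c ^ 2 / σ ^ 2) ^ 2 / 4 *
          (2 * (∑ j, ‖(V * Vᴴ) i j‖ ^ 2) ^ 2 - ∑ j, ‖(V * Vᴴ) i j‖ ^ 4))
      - (∑ k, (σ ^ 2 * ∑ l, ‖B l k‖ ^ 2 + c ^ 2 * ∑ j, ‖V j k‖ ^ 2) - n) ≤ Real.log (r V) := by
  -- A random combination of the conjugated rows, so that pairing `w u` with the rows of V gives
  -- c·(Au).
  let w : (Fin n → Fin 4) → Fin n → ℂ := fun u k =>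
    c * ∑ j, Complex.I ^ (u j : ℕ) * star (V j k)
  have hw : ∀ u i, w u ⬝ᵥ V i = c * ∑ j, Complex.I ^ (u j : ℕ) * (V * Vᴴ) i j := by
    intro u i
    simp only [w, dotProduct, Matrix.mul_apply, Matrix.conjTranspose_apply, Finset.mul_sum,
      Finset.sum_mul]
    rw [Finset.sum_comm]
    exact Finset.sum_congr rfl fun j _ => Finset.sum_congr rfl fun k _ => by ring
  have h := fun u => gaussian_rounding_le_log_r hn V B hB hσ (w u)
  refine ⟨(h fun _ => 0).1, ?_⟩
  have hs := Finset.sum_le_sum fun u (_ : u ∈ Finset.univ) => (h u).2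
  have hcard : (Finset.univ : Finset (Fin n → Fin 4)).card = 4 ^ n := by simp
  have n2 : ∀ (u : Fin n → Fin 4) i, ‖w u ⬝ᵥ V i‖ ^ 2 =
      c ^ 2 * ‖∑ j, Complex.I ^ (u j : ℕ) * (V * Vᴴ) i j‖ ^ 2 := fun u i => by
    rw [hw, norm_mul, mul_pow, Complex.norm_real, Real.norm_eq_abs, sq_abs]
  have n4 : ∀ (u : Fin n → Fin 4) i, ‖w u ⬝ᵥ V i‖ ^ 4 =
      c ^ 4 * ‖∑ j, Complex.I ^ (u j : ℕ) * (V * Vᴴ) i j‖ ^ 4 := fun u i => by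
    rw [hw, norm_mul, mul_pow, Complex.norm_real, Real.norm_eq_abs, Even.pow_abs (by decide)]
  have nk : ∀ (u : Fin n → Fin 4) k, ‖w u k‖ ^ 2 =
      c ^ 2 * ‖∑ j, Complex.I ^ (u j : ℕ) * star (V j k)‖ ^ 2 := fun u k => by
    rw [norm_mul, mul_pow, Complex.norm_real, Real.norm_eq_abs, sq_abs]
  simp only [n2, n4, nk, Finset.sum_const, hcard, nsmul_eq_mul] at hs
  rw [Finset.sum_sub_distrib, Finset.sum_sub_distrib, Finset.sum_comm,
    Finset.sum_comm (f := fun (u : Fin n → Fin 4) k => σ ^ 2 * ∑ l, ‖B l k‖ ^ 2 +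
      c ^ 2 * ‖∑ j, Complex.I ^ (u j : ℕ) * star (V j k)‖ ^ 2)] at hs
  simp only [Finset.sum_sub_distrib, Finset.sum_add_distrib, Finset.sum_const, hcard,
    nsmul_eq_mul, ← Finset.mul_sum, ← Finset.sum_div, sum_fourthRoots_norm_sq,
    sum_fourthRoots_norm_pow_four, norm_star] at hs
  have h4 : (0 : ℝ) < 4 ^ n := by positivity
  refine le_of_mul_le_mul_left ?_ h4
  push_cast at hs
  refine le_trans (le_of_eq ?_) hs
  simp only [Finset.sum_sub_distrib, Finset.sum_add_distrib, Finset.sum_const, Finset.card_univ,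
    Fintype.card_fin, nsmul_eq_mul, ← Finset.mul_sum]
  field_simp

theorem exp_le_r {n : ℕ} (hn : 0 < n) (V X : Matrix (Fin n) (Fin n) ℂ)
    (hAI : (1 - V * Vᴴ).PosSemidef) (hX : X ∈ sdpFeasible n) (hX1 : ∀ i, rowForm V X i = 1)
    {β : ℝ} (hβ0 : 0 ≤ β) (hβ1 : β < 1) :
    Real.exp (-(eulerMascheroniConstant * n)) *
        Real.exp (n * (Real.log (1 - β) + β / (1 - β) * ((V * Vᴴ).trace.re / n)
          - 0.273 * β ^ 2 / (1 - β) ^ 2 * (n / (V * Vᴴ).trace.re))) ≤ r V := by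
  have hn' : (0 : ℝ) < n := by exact_mod_cast hn
  have hA : (V * Vᴴ).PosSemidef := Matrix.posSemidef_self_mul_conjTranspose V
  obtain ⟨B, rfl⟩ := exists_eq_conjTranspose_mul_self hX.1
  have hB : ∀ i, ∑ l, ‖(B *ᵥ V i) l‖ ^ 2 = 1 := fun i => by
    have := hX1 i
    rw [rowForm_conjTranspose_mul_self] at this
    exact_mod_cast this
  have hBtr : ∑ k, ∑ l, ‖B l k‖ ^ 2 = (n : ℝ) := by
    have := hX.2
    rw [trace_conjTranspose_mul_self_eq] at this
    exact_mod_cast this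
  have hdiag : ∀ i, (V * Vᴴ) i i = ((∑ k, ‖V i k‖ ^ 2 : ℝ) : ℂ) := fun i => by
    simp only [Matrix.mul_apply, Matrix.conjTranspose_apply]
    push_cast
    refine Finset.sum_congr rfl fun k _ => ?_
    rw [Complex.star_def, Complex.mul_conj, Complex.normSq_eq_norm_sq]
    push_cast; rfl
  set a : Fin n → ℝ := fun i => ∑ k, ‖V i k‖ ^ 2 with ha
  have ha0 : ∀ i, 0 ≤ a i := fun i => by positivity
  have htr : (V * Vᴴ).trace.re = ∑ i, a i := by
    simp only [Matrix.trace, Matrix.diag_apply, hdiag, Complex.re_sum, Complex.ofReal_re, ha]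
  set T := (V * Vᴴ).trace.re with hT
  have hVne : ∀ i, V i ≠ 0 := fun i h0 => by
    have := hB i
    simp [h0] at this
  -- Each B v_i has unit norm, so no row of V vanishes.
  have hTpos : 0 < T := by
    rw [htr]
    refine Finset.sum_pos (fun i _ => lt_of_le_of_ne (ha0 i) fun h => hVne i ?_) ⟨⟨0, hn⟩, by simp⟩
    funext k
    have := (Finset.sum_eq_zero_iff_of_nonneg fun k _ => by positivity).1 h.symm k
      (Finset.mem_univ k)
    simpa using this
  have hβ : 0 < 1 - β := by linarith
  set σ := Real.sqrt (1 - β)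
  have hσ : 0 < σ := Real.sqrt_pos.2 hβ
  have hσ2 : σ ^ 2 = 1 - β := Real.sq_sqrt hβ.le
  have hlogσ : 2 * Real.log σ = Real.log (1 - β) := by
    rw [← hσ2, Real.log_pow]; norm_num
  -- Chosen so that the Gaussian part has energy (1 - β)n and the shift has mean energy βn, whence
  -- the normalization cost cancels in `hcost`.
  set c := Real.sqrt (β * n / T)
  have hc2 : c ^ 2 = β * n / T := Real.sq_sqrt (by positivity)
  obtain ⟨hr, h⟩ := le_log_r hn V B hB hσ c
  rw [hσ2, hc2, hlogσ] at h
  set κ := β * n / T / (1 - β) with hκ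
  have hκ0 : 0 ≤ κ := by positivity
  have hcost : ∑ k, ((1 - β) * ∑ l, ‖B l k‖ ^ 2 + β * n / T * ∑ j, ‖V j k‖ ^ 2) - n = 0 := by
    rw [Finset.sum_add_distrib, ← Finset.mul_sum, ← Finset.mul_sum, hBtr,
      Finset.sum_comm (f := fun k j => ‖V j k‖ ^ 2), ← htr]
    field_simp
    ring
  rw [hcost, sub_zero] at h
  have hterm : ∀ i, Real.log (1 - β) - eulerMascheroniConstant + κ * a i ^ 2
        - κ ^ 2 * 0.273 * a i ≤
      Real.log (1 - β) - eulerMascheroniConstant + κ * ∑ j, ‖(V * Vᴴ) i j‖ ^ 2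
        - κ ^ 2 / 4 * (2 * (∑ j, ‖(V * Vᴴ) i j‖ ^ 2) ^ 2 - ∑ j, ‖(V * Vᴴ) i j‖ ^ 4) := by
    intro i
    have hnorm : ‖(V * Vᴴ) i i‖ = a i := by
      rw [hdiag, Complex.norm_real, Real.norm_of_nonneg (ha0 i)]
    have h2 : a i ^ 2 ≤ ∑ j, ‖(V * Vᴴ) i j‖ ^ 2 := by
      rw [← hnorm]
      exact Finset.single_le_sum (f := fun j => ‖(V * Vᴴ) i j‖ ^ 2) (fun _ _ => by positivity)
        (Finset.mem_univ i)
    have h4 : a i ^ 4 ≤ ∑ j, ‖(V * Vᴴ) i j‖ ^ 4 := by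
      rw [← hnorm]
      exact Finset.single_le_sum (f := fun j => ‖(V * Vᴴ) i j‖ ^ 4) (fun _ _ => by positivity)
        (Finset.mem_univ i)
    have hq : ∑ j, ‖(V * Vᴴ) i j‖ ^ 2 ≤ a i := by
      have := sum_norm_sq_row_le hA hAI i
      rwa [hdiag, Complex.ofReal_re] at this
    exact add_mul_sub_mul_le _ hκ0 (ha0 i) h2 hq h4
  have hsum := (Finset.sum_le_sum fun i (_ : i ∈ Finset.univ) => hterm i).trans h
  simp only [Finset.sum_sub_distrib, Finset.sum_add_distrib, Finset.sum_const, Finset.card_univ,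
    Fintype.card_fin, nsmul_eq_mul, ← Finset.mul_sum, ← htr] at hsum
  -- Cauchy–Schwarz leaves a bound that depends on the diagonal only through its sum T.
  have hCS : T ^ 2 / n ≤ ∑ i, a i ^ 2 := by
    have := sq_sum_le_card_mul_sum_sq (s := Finset.univ) (f := a)
    rw [← htr, Finset.card_univ, Fintype.card_fin] at this
    rw [div_le_iff₀ hn']
    linarith
  have hCS2 := mul_le_mul_of_nonneg_left hCS hκ0
  rw [← Real.exp_add, ← Real.le_log_iff_exp_le hr]
  have e1 : κ * (T ^ 2 / n) = n * (β / (1 - β) * (T / n)) := by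
    rw [hκ]; field_simp
  have e2 : κ ^ 2 * 0.273 * T = n * (0.273 * β ^ 2 / (1 - β) ^ 2 * (n / T)) := by
    rw [hκ]; field_simp
  rw [e1] at hCS2
  rw [e2] at hsum
  linarith

end PSDPermanent

end

theorem mainTheorem5 (n : ℕ) (hn : 1 ≤ n) (V A X : Matrix (Fin n) (Fin n) ℂ)
    (hA : A = V * Vᴴ) (hAI : (1 - A).PosSemidef)
    (hX : PSDPermanent.IsSDPMaximizer V X)
    (hX1 : ∀ i, PSDPermanent.rowForm V X i = 1)
    (β : ℝ) (hβ0 : 0 ≤ β) (hβ1 : β < 1) :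
    ((Real.exp (-(n : ℝ)) * PSDPermanent.r V : ℝ) : ℂ) ≤ A.permanent ∧
    Real.exp (-((Real.eulerMascheroniConstant + 1) * (n : ℝ))) *
        Real.exp ((n : ℝ) * (Real.log (1 - β)
          + β / (1 - β) * (A.trace.re / (n : ℝ))
          - 0.273 * β ^ 2 / (1 - β) ^ 2 * ((n : ℝ) / A.trace.re)))
      ≤ Real.exp (-(n : ℝ)) * PSDPermanent.r V := by
  subst hA
  refine ⟨PSDPermanent.exp_neg_mul_r_le_permanent hn V, ?_⟩
  have h := PSDPermanent.exp_le_r hn V X hAI hX.1 hX1 hβ0 hβ1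
  have h1 : Real.exp (-((Real.eulerMascheroniConstant + 1) * (n : ℝ))) =
      Real.exp (-(n : ℝ)) * Real.exp (-(Real.eulerMascheroniConstant * n)) := by
    rw [← Real.exp_add]; ring_nf
  rw [h1, mul_assoc]
  exact mul_le_mul_of_nonneg_left h (Real.exp_pos _).le
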